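/- For a partially ordered set $(P,\le)$, a net $(x_\gamma)_{\gamma\in\Gamma}$ in $P$ order converges to $x\in P$ if there are nets $(y_\gamma)_{\gamma\in\Gamma}$ and $(z_\gamma)_{\gamma\in\Gamma}$ in $P$, over the same directed set, such that $y_\gamma\le x_\gamma\le z_\gamma$ for all $\gamma$, $(y_\gamma)$ is increasing with $\bigvee_\gamma y_\gamma=x$, and $(z_\gamma)$ is decreasing with $\bigwedge_\gamma z_\gamma=x$ (supremum and infimum in $P$). The order topology $\tau_o(P)$ is the topology on $P$ whose closed sets are the subsets $X\subseteq P$ such that no net in $X$ order converges in $P$ to a point outside $X$. For $P_0\subseteq P$ write $\tau_o(P)|P_0$ for the subspace topology on $P_0$. Let $M$ be a von Neumann algebra, i.e. a $C^\ast$-algebra that is a dual Banach space. Let $M_{sa}$ be its self-adjoint part with the order given by the positive cone $\{x^\ast x : x\in M\}$, let $M_{sa}^1=\{x\in M_{sa} : \|x\|\le 1\}$ and let $P(M)=\{p\in M : p=p^\ast=p^2\}\subseteq M_{sa}^1$, both with the order inherited from $M_{sa}$. Then the following statements are equivalent: 1. $M$ is abelian; 2. $\tau_o(M_{sa})|P(M)=\tau_o(M_{sa}^1)|P(M)$;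 3. $\tau_o(M_{sa})|P(M)=\tau_o(P(M))$; 4. $\tau_o(M_{sa})|M_{sa}^1=\tau_o(M_{sa}^1)$. -/

import Mathlib

open Set

universe u v

/-- Order convergence of a net `x : Γ → P` to `a` in the poset `P`: there are nets `y`, `z` in `P`
over the same index set with `y γ ≤ x γ ≤ z γ` for all `γ`, `y` increasing with supremum `a`, and
`z` decreasing with infimum `a` (supremum and infimum being taken in `P`). -/
def OrderConverges {P : Type u} [PartialOrder P] {Γ : Type v} [Preorder Γ] (x : Γ → P) (a : P) :
    Prop :=
  ∃ y z : Γ → P, (∀ γ, y γ ≤ x γ ∧ x γ ≤ z γ) ∧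
    (Monotone y ∧ IsLUB (range y) a) ∧ (Antitone z ∧ IsGLB (range z) a)

/-- A subset of a poset `P` is order closed if no net in it order converges to a point outside.
Index sets in the universe of `P` suffice, as `IsOrderClosed.mem_of_orderConverges` shows. -/
def IsOrderClosed {P : Type u} [PartialOrder P] (X : Set P) : Prop :=
  ∀ (Γ : Type u) [Preorder Γ] [IsDirectedOrder Γ] [Nonempty Γ] (x : Γ → P) (a : P),
    (∀ γ, x γ ∈ X) → OrderConverges x a → a ∈ X

/-- An order closed set contains the order limits of its nets, whatever the universe of the
index set. -/
theorem IsOrderClosed.mem_of_orderConverges {P : Type u} [PartialOrder P] {X : Set P}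
    (hX : IsOrderClosed X) {Γ : Type v} [Preorder Γ] [IsDirectedOrder Γ] [Nonempty Γ]
    {x : Γ → P} {a : P} (hx : ∀ γ, x γ ∈ X) (h : OrderConverges x a) : a ∈ X := by
  obtain ⟨y, z, hyz, ⟨hy, hya⟩, ⟨hz, hza⟩⟩ := h
  let t : Γ → P × Pᵒᵈ := fun γ => (y γ, OrderDual.toDual (z γ))
  have hdir : IsDirectedOrder (range t) := ⟨by
    rintro ⟨_, γ, rfl⟩ ⟨_, γ', rfl⟩
    obtain ⟨δ, h, h'⟩ := exists_ge_ge γ γ'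
    exact ⟨⟨t δ, δ, rfl⟩, ⟨hy h, hz h⟩, ⟨hy h', hz h'⟩⟩⟩
  have hne : Nonempty (range t) := ⟨⟨t (Classical.arbitrary Γ), mem_range_self _⟩⟩
  choose g hg using fun s : range t => s.2
  have hy' : ∀ s : range t, s.1.1 = y (g s) := fun s => (congrArg Prod.fst (hg s)).symm
  have hz' : ∀ s : range t, OrderDual.ofDual s.1.2 = z (g s) := fun s =>
    (congrArg (fun q : P × Pᵒᵈ => OrderDual.ofDual q.2) (hg s)).symm
  refine hX (range t) (fun s => x (g s)) a (fun s => hx _)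
    ⟨fun s => s.1.1, fun s => OrderDual.ofDual s.1.2, fun s => ?_, ⟨fun s s' h => h.1, ?_⟩,
      ⟨fun s s' h => h.2, ?_⟩⟩
  · exact ⟨(hy' s).trans_le (hyz (g s)).1, (hyz (g s)).2.trans_eq (hz' s).symm⟩
  · have e : range (fun s : range t => s.1.1) = range y := by
      ext b
      simp [t]
    rwa [e]
  · have e : range (fun s : range t => OrderDual.ofDual s.1.2) = range z := by
      ext b
      simp [t]
    rwa [e]

/-- A net order converging to `a` still does so along a cofinal subset of its index set. -/
theorem OrderConverges.restrict {P : Type u} [PartialOrder P] {Γ : Type v} [Preorder Γ]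
    {x : Γ → P} {a : P} (h : OrderConverges x a) (S : Set Γ) (hS : ∀ γ, ∃ δ ∈ S, γ ≤ δ) :
    OrderConverges (fun s : S => x s) a := by
  obtain ⟨y, z, hyz, ⟨hy, hya⟩, ⟨hz, hza⟩⟩ := h
  refine ⟨fun s => y s, fun s => z s, fun s => hyz s, ⟨fun s s' h => hy h, ?_, ?_⟩,
    ⟨fun s s' h => hz h, ?_, ?_⟩⟩
  · rintro _ ⟨s, rfl⟩
    exact hya.1 (mem_range_self _)
  · intro b hb
    refine hya.2 ?_
    rintro _ ⟨γ, rfl⟩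
    obtain ⟨δ, hδ, h⟩ := hS γ
    exact (hy h).trans (hb ⟨⟨δ, hδ⟩, rfl⟩)
  · rintro _ ⟨s, rfl⟩
    exact hza.1 (mem_range_self _)
  · intro b hb
    refine hza.2 ?_
    rintro _ ⟨γ, rfl⟩
    obtain ⟨δ, hδ, h⟩ := hS γ
    exact le_trans (hb ⟨⟨δ, hδ⟩, rfl⟩) (hz h)

theorem IsOrderClosed.union {P : Type u} [PartialOrder P] {A B : Set P}
    (hA : IsOrderClosed A) (hB : IsOrderClosed B) : IsOrderClosed (A ∪ B) := by
  intro Γ _ _ _ x a hx h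
  have key : ∀ C : Set P, IsOrderClosed C → (∀ γ, ∃ δ ∈ {δ | x δ ∈ C}, γ ≤ δ) → a ∈ C := by
    intro C hC hcof
    have : IsDirectedOrder {δ | x δ ∈ C} := ⟨fun s s' => by
      obtain ⟨γ, h, h'⟩ := exists_ge_ge s.1 s'.1
      obtain ⟨δ, hδ, h''⟩ := hcof γ
      exact ⟨⟨δ, hδ⟩, h.trans h'', h'.trans h''⟩⟩
    have : Nonempty {δ | x δ ∈ C} := by
      obtain ⟨δ, hδ, -⟩ := hcof (Classical.arbitrary Γ)
      exact ⟨⟨δ, hδ⟩⟩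
    exact hC _ _ a (fun s => s.2) (h.restrict _ hcof)
  by_cases hcA : ∀ γ, ∃ δ ∈ {δ | x δ ∈ A}, γ ≤ δ
  · exact Or.inl (key A hA hcA)
  · refine Or.inr (key B hB fun γ => ?_)
    push Not at hcA
    obtain ⟨γ₀, h₀⟩ := hcA
    obtain ⟨δ, h, h'⟩ := exists_ge_ge γ γ₀
    exact ⟨δ, (hx δ).resolve_left fun hδ => h₀ δ hδ h', h⟩

/-- The order topology `τ_o(P)` of a poset `P`: its closed sets are the order closed sets.
(This is not the topology generated by open rays.) -/
@[reducible] def orderConvergenceTopology (P : Type u) [PartialOrder P] : TopologicalSpace P :=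
  TopologicalSpace.ofClosed {X | IsOrderClosed X}
    (fun Γ _ _ _ _ _ hx _ => (hx (Classical.arbitrary Γ)).elim)
    (fun _ hA Γ _ _ _ x a hx h => mem_sInter.2 fun X hXA =>
      hA hXA Γ x a (fun γ => mem_sInter.1 (hx γ) X hXA) h)
    (fun _ hA _ hB => hA.union hB)

/-- `M_sa^1`, the self-adjoint part of the closed unit ball, as a subset of `M_sa`. -/
def selfAdjointUnitBall (M : Type u) [CStarAlgebra M] : Set (selfAdjoint M) :=
  {x | ‖(x : M)‖ ≤ 1}

/-- `P(M)`, the set of projections (`p = p* = p²`), as a subset of `M_sa`. -/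
def projectionSet (M : Type u) [CStarAlgebra M] : Set (selfAdjoint M) :=
  {x | IsStarProjection (x : M)}

theorem projectionSet_subset_selfAdjointUnitBall (M : Type u) [CStarAlgebra M] :
    projectionSet M ⊆ selfAdjointUnitBall M := by
  intro x hx
  have hx' : IsStarProjection (x : M) := hx
  exact hx'.norm_le

/-! If `M` is abelian, `M_sa` is a lattice and arbitrary families of projections have infima and
suprema in `M` that are again projections. Nets bounding a net of the unit ball can then be
truncated at `-1` and `1`, and nets bounding a net of projections can be replaced by tail infima and
suprema. So order convergence in the subset agrees with that in `M_sa` (`OrderConverges.of_val_Icc`,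
`OrderConverges.of_val_projectionSet`).

Conversely, let `p` be a noncentral projection and `x = p b (1 - p) ≠ 0`. Rotating `p` by unitaries
gives projections `q n ≠ p` tending to `p` in norm along a curve with derivative `-(x + x⋆)`. In
`M_sa` an order closed set containing all `q n` contains `p`, since `p ± ε` are available as bounds.
In the unit ball the bounds must stay below `1`: any `z ≤ 1` above infinitely many `q n` fixes `p`
and the tangent vector, hence dominates `p + r x⋆x`. Upper bounds therefore cannot decrease to `p`,
and the set of all `q n` is order closed in the ball (`exists_isOrderClosed_range_inclusion`).
Either equality of topologies on the projections thus makes every projection central; binary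
expansion into projections then makes `M` abelian.

The predual enters only through Banach–Alaoglu: order intervals are intersections of norm balls, so
monotone completeness follows, and with it the spectral projections. -/

open Filter Metric in
/-- Banach–Alaoglu for the closed balls of a W⋆-algebra: some point lies in every closed ball that
belongs to a given proper filter. -/
theorem WStarAlgebra.exists_forall_mem_closedBall {M : Type u} [CStarAlgebra M] [WStarAlgebra M]
    (F : Filter M) [F.NeBot] :
    ∃ x, ∀ c r, closedBall c r ∈ F → x ∈ closedBall c r := by
  obtain ⟨X, _, _, _, ⟨e⟩⟩ := WStarAlgebra.exists_predual (M := M)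
  by_cases h : ∃ c r, closedBall c r ∈ F
  swap
  · push Not at h
    exact ⟨0, fun c r hc => (h c r hc).elim⟩
  obtain ⟨c₀, r₀, h₀⟩ := h
  let g : M → WeakDual ℂ X := fun m => StrongDual.toWeakDual (e.symm m)
  have hg : ∀ c r, g ⁻¹' (WeakDual.toStrongDual ⁻¹' closedBall (e.symm c) r) = closedBall c r := by
    intro c r
    ext m
    simp [g, mem_closedBall]
  have hmem : ∀ c r, closedBall c r ∈ F →
      map g F ≤ 𝓟 (WeakDual.toStrongDual ⁻¹' closedBall (e.symm c) r) := by
    intro c r hF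
    rw [le_principal_iff, mem_map, hg]
    exact hF
  obtain ⟨φ, -, hφ⟩ := WeakDual.isCompact_closedBall (𝕜 := ℂ) (e.symm c₀) r₀ (hmem c₀ r₀ h₀)
  refine ⟨e (WeakDual.toStrongDual φ), fun c r hF => ?_⟩
  have h1 : φ ∈ WeakDual.toStrongDual ⁻¹' closedBall (e.symm c) r :=
    isClosed_iff_clusterPt.1 (WeakDual.isClosed_closedBall (𝕜 := ℂ) (e.symm c) r) φ
      (hφ.mono (hmem c r hF))
  rw [← hg]
  simpa [g] using h1

/-! ### Order intervals and norm balls. -/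

section Order

variable {M : Type u} [CStarAlgebra M] [PartialOrder M] [StarOrderedRing M]

theorem IsSelfAdjoint.norm_le_iff_mem_Icc {x : M} (hx : IsSelfAdjoint x) {r : ℝ} (hr : 0 ≤ r) :
    ‖x‖ ≤ r ↔ x ∈ Icc (-algebraMap ℝ M r) (algebraMap ℝ M r) := by
  rcases subsingleton_or_nontrivial M with h | h
  · simp [Subsingleton.elim x 0, hr, Subsingleton.elim (algebraMap ℝ M r) 0]
  constructor
  · intro h
    have := algebraMap_le_algebraMap (β := M) |>.2 h
    exact ⟨(neg_le_neg this).trans hx.neg_algebraMap_norm_le_self,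
      hx.le_algebraMap_norm_self.trans this⟩
  · rintro ⟨h1, h2⟩
    rw [← map_neg, algebraMap_le_iff_le_spectrum] at h1
    rw [le_algebraMap_iff_spectrum_le] at h2
    rcases CStarAlgebra.norm_or_neg_norm_mem_spectrum (a := x) with h | h
    · exact h2 _ h
    · exact neg_le_neg_iff.1 (h1 _ h)

/-- Order intervals centred at a self-adjoint element are intersections of norm balls. -/
theorem mem_Icc_algebraMap_iff_forall_norm_le {x : M} {r : ℝ} (hr : 0 ≤ r) :
    x ∈ Icc (-algebraMap ℝ M r) (algebraMap ℝ M r) ↔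
      ∀ t : ℝ, ‖x + algebraMap ℂ M (t * Complex.I)‖ ≤ √(r ^ 2 + t ^ 2) := by
  have key : ∀ t : ℝ,
      star (x + algebraMap ℂ M (t * Complex.I)) * (x + algebraMap ℂ M (t * Complex.I))
      = star x * x + t • (Complex.I • (star x - x)) + algebraMap ℝ M (t ^ 2) := by
    intro t
    simp only [Algebra.algebraMap_eq_smul_one, star_add, star_smul, star_one, add_mul, mul_add,
      smul_mul_assoc, mul_smul_comm, one_mul, mul_one, smul_sub]
    simp only [← Complex.coe_smul, smul_smul]
    have h1 : star ((t:ℂ) * Complex.I) = - (t * Complex.I) := by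
      simp [Complex.conj_ofReal]
    have h2 : (t:ℂ) * Complex.I * -(t * Complex.I) = ((t^2 : ℝ) : ℂ) := by
      push_cast; linear_combination (-(t:ℂ)^2) * Complex.I_mul_I
    rw [h1, smul_add, smul_smul, h2, neg_smul]
    abel
  have hsq : ∀ t : ℝ, ‖x + algebraMap ℂ M (t * Complex.I)‖ ≤ √(r ^ 2 + t ^ 2) ↔
      star x * x + t • (Complex.I • (star x - x)) + algebraMap ℝ M (t ^ 2) ≤
        algebraMap ℝ M (r ^ 2 + t ^ 2) := by
    intro t
    rw [Real.le_sqrt (norm_nonneg _) (by positivity), sq ‖_‖, ← CStarRing.norm_star_mul_self,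
      CStarAlgebra.norm_le_iff_le_algebraMap _ (by positivity) (star_mul_self_nonneg _), key]
  simp only [hsq, map_add, add_le_add_iff_right]
  constructor
  · intro h t
    have hx : IsSelfAdjoint x := by
      refine IsSelfAdjoint.of_ge h.1 ?_
      exact (IsSelfAdjoint.algebraMap M (IsSelfAdjoint.all r)).neg
    rw [hx.star_eq, sub_self, smul_zero, smul_zero, add_zero]
    have h' := (hx.norm_le_iff_mem_Icc hr).2 h
    rw [← CStarAlgebra.norm_le_iff_le_algebraMap _ (by positivity) hx.mul_self_nonneg]
    calc ‖x * x‖ ≤ ‖x‖ * ‖x‖ := norm_mul_le _ _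
      _ ≤ r ^ 2 := by rw [sq]; gcongr
  · intro h
    set d := Complex.I • (star x - x) with hd
    have h1 : ∀ t : ℝ, t • d ≤ algebraMap ℝ M (r ^ 2) := fun t =>
      (le_add_of_nonneg_left (star_mul_self_nonneg x)).trans (h t)
    -- All real multiples of `d` share one upper bound, so rescaling by `1 / (n + 1)` pushes that
    -- bound to `0`.
    have h2 : ∀ s : ℝ, s • d ≤ 0 := by
      intro s
      have hlim : Filter.Tendsto (fun n : ℕ => (1 / ((n : ℝ) + 1)) • algebraMap ℝ M (r ^ 2))
          Filter.atTop (nhds ((0 : ℝ) • algebraMap ℝ M (r ^ 2))) :=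
        tendsto_one_div_add_atTop_nhds_zero_nat.smul_const _
      rw [zero_smul] at hlim
      refine ge_of_tendsto' hlim fun n => ?_
      have h3 := smul_le_smul_of_nonneg_left (h1 (((n : ℝ) + 1) * s))
        (show 0 ≤ 1 / ((n : ℝ) + 1) by positivity)
      rwa [smul_smul, ← mul_assoc, one_div_mul_cancel (by positivity), one_mul] at h3
    have h3 : d = 0 := by
      refine le_antisymm (by simpa using h2 1) ?_
      simpa using h2 (-1)
    have hx : IsSelfAdjoint x := by
      rw [hd, smul_eq_zero, sub_eq_zero] at h3
      exact h3.resolve_left Complex.I_ne_zero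
    refine (hx.norm_le_iff_mem_Icc hr).1 ?_
    have := (hsq 0).2 (by simpa using h 0)
    simpa [Real.sqrt_sq hr] using this

end Order

/-! ### Monotone completeness. -/

section MonotoneComplete

variable {M : Type u} [CStarAlgebra M] [PartialOrder M] [StarOrderedRing M] [WStarAlgebra M]

/-- A W⋆-algebra is monotone complete. -/
theorem WStarAlgebra.exists_isLUB {S : Set M} (hne : S.Nonempty)
    (hdir : DirectedOn (· ≤ ·) S) (hbdd : BddAbove S) : ∃ s, IsLUB S s := by
  obtain ⟨x₀, hx₀⟩ := hne
  have : Nonempty S := ⟨⟨x₀, hx₀⟩⟩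
  have : IsDirectedOrder S := ⟨fun a b => by
    obtain ⟨c, hc, h⟩ := hdir a a.2 b b.2
    exact ⟨⟨c, hc⟩, h⟩⟩
  let F : Filter M := Filter.map (Subtype.val : S → M) Filter.atTop
  obtain ⟨s, hs⟩ := WStarAlgebra.exists_forall_mem_closedBall F
  have key : ∀ (a : M) (r : ℝ), 0 ≤ r → (∃ x ∈ S, ∀ y ∈ S, x ≤ y →
      y - a ∈ Icc (-algebraMap ℝ M r) (algebraMap ℝ M r)) →
      s - a ∈ Icc (-algebraMap ℝ M r) (algebraMap ℝ M r) := by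
    rintro a r hr ⟨x, hx, hxy⟩
    rw [mem_Icc_algebraMap_iff_forall_norm_le hr]
    intro t
    have hball : Metric.closedBall (a - algebraMap ℂ M (t * Complex.I)) (√(r ^ 2 + t ^ 2)) ∈ F := by
      refine Filter.mem_map.2 (Filter.mem_of_superset (Filter.Ici_mem_atTop (⟨x, hx⟩ : S)) ?_)
      intro y hy
      have := (mem_Icc_algebraMap_iff_forall_norm_le hr).1 (hxy y y.2 hy) t
      rwa [mem_preimage, mem_closedBall_iff_norm, sub_sub_eq_add_sub, ← sub_add_eq_add_sub]
    have := hs _ _ hball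
    rwa [mem_closedBall_iff_norm, sub_sub_eq_add_sub, ← sub_add_eq_add_sub] at this
  have hhalf : ∀ r : ℝ, algebraMap ℝ M (r / 2) + algebraMap ℝ M (r / 2) = algebraMap ℝ M r := by
    intro r
    rw [← map_add, add_halves]
  obtain ⟨B, hB⟩ := hbdd
  -- With `ρ = ‖b - x‖`, the elements of `S` above `x` lie in both `[x, x + ρ]` and `[b - ρ, b]`,
  -- hence so does `s`.
  have hup : ∀ b ∈ upperBounds S, ∀ x ∈ S, x ≤ s ∧ s ≤ b := by
    intro b hb x hx
    have hbx : IsSelfAdjoint (b - x) := .of_nonneg (sub_nonneg.2 (hb hx))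
    have hle := hbx.le_algebraMap_norm_self
    have hr : 0 ≤ ‖b - x‖ / 2 := by positivity
    constructor
    · have := (key (x + algebraMap ℝ M (‖b - x‖ / 2)) _ hr ⟨x, hx, fun y hy hxy => ⟨?_, ?_⟩⟩).1
      · simpa using this
      · simpa using hxy
      · rw [sub_le_iff_le_add, add_left_comm, hhalf]
        exact (hb hy).trans (sub_le_iff_le_add'.1 hle)
    · have := (key (b - algebraMap ℝ M (‖b - x‖ / 2)) _ hr ⟨x, hx, fun y hy hxy => ⟨?_, ?_⟩⟩).2
      · simpa using this
      · rw [le_sub_iff_add_le, neg_add_eq_sub, sub_sub, hhalf]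
        exact (sub_le_comm.1 hle).trans hxy
      · simpa using hb hy
  exact ⟨s, fun x hx => (hup B hB x hx).1, fun b hb => (hup b hb x₀ hx₀).2⟩

end MonotoneComplete

/-! ### Projections and their suprema and infima. -/

section Projections

variable {M : Type u} [CStarAlgebra M] [PartialOrder M] [StarOrderedRing M]

theorem IsStarProjection.mul_eq_zero_of_le_one_sub {a e : M} (he : IsStarProjection e)
    (ha : 0 ≤ a) (hae : a ≤ 1 - e) : a * e = 0 ∧ e * a = 0 := by
  have := he.one_sub.mul_right_and_mul_left_of_nonneg_of_le ha hae
  constructor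
  · simpa [mul_sub] using this.1
  · simpa [sub_mul] using this.2

/-- Multiplication by a projection below an element between `0` and `1`. -/
theorem IsStarProjection.mul_eq_of_le {p s : M} (hp : IsStarProjection p) (hps : p ≤ s)
    (hs : s ≤ 1) : s * p = p ∧ p * s = p := by
  have := hp.mul_eq_zero_of_le_one_sub (sub_nonneg.2 hs) (sub_le_sub_left hps 1)
  constructor
  · have h := this.1
    rw [sub_mul, one_mul, sub_eq_zero] at h
    exact h.symm
  · have h := this.2
    rw [mul_sub, mul_one, sub_eq_zero] at h
    exact h.symm

theorem mul_self_le_of_mem_Icc {s : M} (h0 : 0 ≤ s) (h1 : s ≤ 1) : s * s ≤ s := by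
  have := Commute.mul_nonneg h0 (sub_nonneg.2 h1) ((Commute.one_right s).sub_right (.refl s))
  rwa [mul_sub, mul_one, sub_nonneg] at this

theorem isStarProjection_of_mul_self_ge {s : M} (h0 : 0 ≤ s) (h1 : s ≤ 1) (h : s ≤ s * s) :
    IsStarProjection s :=
  ⟨(mul_self_le_of_mem_Icc h0 h1).antisymm h, .of_nonneg h0⟩

/-- Each `p ∈ S` is fixed by `s`, so `0 ≤ s (1 - p) s = s² - p`. Thus `s²` is an upper bound and `s
≤ s²`. -/
theorem IsLUB.isStarProjection {S : Set M} {s : M} (hne : S.Nonempty)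
    (hS : ∀ p ∈ S, IsStarProjection p) (hs : IsLUB S s) : IsStarProjection s := by
  obtain ⟨p₀, hp₀⟩ := hne
  have h0 : 0 ≤ s := (hS p₀ hp₀).nonneg.trans (hs.1 hp₀)
  have h1 : s ≤ 1 := hs.2 fun p hp => (hS p hp).le_one
  refine isStarProjection_of_mul_self_ge h0 h1 (hs.2 fun p hp => ?_)
  have := (IsSelfAdjoint.of_nonneg h0).conjugate_nonneg (hS p hp).one_sub_nonneg
  rwa [mul_sub, mul_one, sub_mul, ((hS p hp).mul_eq_of_le (hs.1 hp) h1).1,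
    ((hS p hp).mul_eq_of_le (hs.1 hp) h1).2, sub_nonneg] at this

theorem isLUB_image_one_sub {S : Set M} {s : M} : IsLUB ((1 - ·) '' S) (1 - s) ↔ IsGLB S s := by
  constructor
  · rintro ⟨h1, h2⟩
    refine ⟨fun x hx => (sub_le_sub_iff_left 1).1 (h1 ⟨x, hx, rfl⟩), fun b hb => ?_⟩
    refine (sub_le_sub_iff_left 1).1 (h2 ?_)
    rintro _ ⟨x, hx, rfl⟩
    exact sub_le_sub_left (hb hx) 1
  · rintro ⟨h1, h2⟩
    refine ⟨?_, fun b hb => ?_⟩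
    · rintro _ ⟨x, hx, rfl⟩
      exact sub_le_sub_left (h1 hx) 1
    · refine sub_le_comm.1 (h2 fun x hx => sub_le_comm.1 (hb ⟨x, hx, rfl⟩))

theorem IsGLB.isStarProjection {S : Set M} {s : M} (hne : S.Nonempty)
    (hS : ∀ p ∈ S, IsStarProjection p) (hs : IsGLB S s) : IsStarProjection s := by
  refine isStarProjection_one_sub_iff.1 ((isLUB_image_one_sub.2 hs).isStarProjection
    (hne.image _) ?_)
  rintro _ ⟨p, hp, rfl⟩
  exact (hS p hp).one_sub

theorem nsmul_mul_one_sub_pow_le {b : M} (h0 : 0 ≤ b) (h1 : b ≤ 1) (n : ℕ) :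
    n • (b * (1 - b) ^ n) ≤ 1 := by
  have hc : ∀ n, Commute b ((1 - b) ^ n) := fun n =>
    ((Commute.one_right b).sub_right (.refl b)).pow_right n
  have hpow : ∀ n, 0 ≤ (1 - b) ^ n := fun n => CStarAlgebra.pow_nonneg (sub_nonneg.2 h1) n
  -- The extra term makes the induction close: the left side drops by `(n + 1) b² (1 - b)^n` at each
  -- step.
  have key : n • (b * (1 - b) ^ n) + (1 - b) ^ n ≤ 1 := by
    induction n with
    | zero => simp
    | succ n ih =>
      refine le_trans (sub_nonneg.1 ?_) ih
      have h : 0 ≤ (n + 1) • (b * b * (1 - b) ^ n) :=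
        nsmul_nonneg (((hc n).mul_left (hc n)).mul_nonneg
          (IsSelfAdjoint.of_nonneg h0).mul_self_nonneg (hpow n)) _
      convert h using 1
      rw [pow_succ']
      simp only [add_smul, one_smul, mul_sub, sub_mul, one_mul, smul_sub, mul_assoc]
      abel
  exact (le_add_of_nonneg_right (hpow n)).trans key

theorem mul_eq_zero_of_conjugate_eq_zero {q s : M} (hq : 0 ≤ q) (hs : IsSelfAdjoint s)
    (h : s * q * s = 0) : q * s = 0 := by
  have h1 : star (CFC.sqrt q * s) * (CFC.sqrt q * s) = 0 := by
    rw [star_mul, hs.star_eq, (CFC.sqrt_nonneg q).star_eq, mul_assoc s, ← mul_assoc (CFC.sqrt q),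
      CFC.sqrt_mul_sqrt_self q, ← mul_assoc, h]
  rw [CStarRing.star_mul_self_eq_zero_iff] at h1
  rw [← CFC.sqrt_mul_sqrt_self q, mul_assoc, h1, mul_zero]

end Projections

/-! ### Spectral projections and binary expansion. -/

section SpectralProjections

variable {M : Type u} [CStarAlgebra M] [PartialOrder M] [StarOrderedRing M] [WStarAlgebra M]

theorem WStarAlgebra.exists_isGLB {S : Set M} (hne : S.Nonempty)
    (hdir : DirectedOn (· ≥ ·) S) (hbdd : BddBelow S) : ∃ s, IsGLB S s := by
  obtain ⟨s, hs⟩ := WStarAlgebra.exists_isLUB (hne.image (1 - ·)) (S := (1 - ·) '' S) (by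
    rintro _ ⟨x, hx, rfl⟩ _ ⟨y, hy, rfl⟩
    obtain ⟨z, hz, hxz, hyz⟩ := hdir x hx y hy
    exact ⟨_, ⟨z, hz, rfl⟩, sub_le_sub_left hxz 1, sub_le_sub_left hyz 1⟩) (by
    obtain ⟨b, hb⟩ := hbdd
    refine ⟨1 - b, ?_⟩
    rintro _ ⟨x, hx, rfl⟩
    exact sub_le_sub_left (hb hx) 1)
  refine ⟨1 - s, isLUB_image_one_sub.1 ?_⟩
  rwa [sub_sub_cancel]

/-- The kernel projection of an element between `0` and `1`. -/
theorem WStarAlgebra.exists_isGreatest_mul_eq_zero {b : M} (h0 : 0 ≤ b) (h1 : b ≤ 1) :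
    ∃ q, IsGreatest {w : M | 0 ≤ w ∧ w ≤ 1 ∧ b * w = 0} q := by
  have hpow : ∀ n, 0 ≤ (1 - b) ^ n := fun n => CStarAlgebra.pow_nonneg (sub_nonneg.2 h1) n
  have hanti := CStarAlgebra.pow_antitone (sub_nonneg.2 h1) (sub_le_self 1 h0)
  -- The powers `(1 - b)^n` decrease to the spectral projection of `b` at `0`.
  obtain ⟨q, hq⟩ := WStarAlgebra.exists_isGLB (range_nonempty fun n : ℕ => (1 - b) ^ n)
    (directedOn_range.2 hanti.directed_ge) ⟨0, by rintro _ ⟨n, rfl⟩; exact hpow n⟩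
  have hq0 : 0 ≤ q := hq.2 (by rintro _ ⟨n, rfl⟩; exact hpow n)
  refine ⟨q, ⟨hq0, ?_, ?_⟩, ?_⟩
  · simpa using hq.1 (mem_range_self 0)
  · set s := CFC.sqrt b
    have hs : 0 ≤ s := CFC.sqrt_nonneg b
    have hss : s * s = b := CFC.sqrt_mul_sqrt_self b
    -- Since `q ≤ (1 - b)^n`, conjugation by `s = √b` gives `s q s ≤ b (1 - b)^n`, which is at most
    -- `1 / n`.
    have hle : ∀ n : ℕ, n • (s * q * s) ≤ 1 := by
      intro n
      have hcomm : Commute ((1 - b) ^ n) s := by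
        have : Commute b s := by rw [← hss]; exact (Commute.refl s).mul_left (.refl s)
        exact ((Commute.one_left s).sub_left this).pow_left n
      refine le_trans (nsmul_le_nsmul_right ?_ n) (nsmul_mul_one_sub_pow_le h0 h1 n)
      have : b * (1 - b) ^ n = s * (1 - b) ^ n * s := by
        rw [mul_assoc, hcomm.eq, ← mul_assoc, hss]
      rw [this]
      exact conjugate_le_conjugate_of_nonneg (hq.1 (mem_range_self n)) hs
    have hzero : s * q * s = 0 := by
      refine le_antisymm ?_ (conjugate_nonneg_of_nonneg hq0 hs)
      have hlim : Filter.Tendsto (fun n : ℕ => (1 / ((n : ℝ) + 1)) • (1 : M))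
          Filter.atTop (nhds ((0 : ℝ) • (1 : M))) :=
        tendsto_one_div_add_atTop_nhds_zero_nat.smul_const _
      rw [zero_smul] at hlim
      refine ge_of_tendsto' hlim fun n => ?_
      have h3 := smul_le_smul_of_nonneg_left (hle (n + 1))
        (show 0 ≤ 1 / ((n : ℝ) + 1) by positivity)
      rwa [← Nat.cast_smul_eq_nsmul ℝ, smul_smul, Nat.cast_succ,
        one_div_mul_cancel (by positivity), one_smul] at h3
    have hqs := mul_eq_zero_of_conjugate_eq_zero hq0 (.of_nonneg hs) hzero
    have : q * b = 0 := by rw [← hss, ← mul_assoc, hqs, zero_mul]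
    simpa [hq0.star_eq, h0.star_eq] using congr(star $this)
  · rintro w ⟨hw0, hw1, hbw⟩
    refine hq.2 ?_
    rintro _ ⟨n, rfl⟩
    have hw : (1 - b) ^ n * w = w := by
      induction n with
      | zero => simp
      | succ n ih => rw [pow_succ, mul_assoc, sub_mul, one_mul, hbw, sub_zero, ih]
    have hw' : w * (1 - b) ^ n = w := by
      simpa [hw0.star_eq, (hpow n).star_eq] using congr(star $hw)
    have hcomm : Commute ((1 - b) ^ n) (1 - w) :=
      (Commute.one_right _).sub_right (hw.trans hw'.symm)
    have := hcomm.mul_nonneg (hpow n) (sub_nonneg.2 hw1)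
    rwa [mul_sub, mul_one, hw, sub_nonneg] at this

theorem WStarAlgebra.exists_isStarProjection_kernel {b : M} (hb : 0 ≤ b) :
    ∃ q, IsStarProjection q ∧ b * q = 0 ∧ ∀ w, 0 ≤ w → b * w = 0 → w * q = w ∧ q * w = w := by
  have hpos : ∀ a : M, 0 < (‖a‖ + 1)⁻¹ := fun a => by positivity
  have hscale : ∀ a : M, 0 ≤ a → 0 ≤ (‖a‖ + 1)⁻¹ • a ∧ (‖a‖ + 1)⁻¹ • a ≤ 1 := by
    intro a ha
    have h0 : 0 ≤ (‖a‖ + 1)⁻¹ • a := smul_nonneg (hpos a).le ha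
    refine ⟨h0, (CStarAlgebra.norm_le_one_iff_of_nonneg _).1 ?_⟩
    rw [norm_smul, Real.norm_of_nonneg (hpos a).le, inv_mul_le_one₀ (by positivity)]
    linarith
  obtain ⟨q, ⟨hq0, hq1, hbq⟩, hq⟩ := WStarAlgebra.exists_isGreatest_mul_eq_zero
    (hscale b hb).1 (hscale b hb).2
  have hproj : IsStarProjection q := by
    refine isStarProjection_of_mul_self_ge hq0 hq1 ?_
    -- Maximality forces idempotence: `2q - q² = 1 - (1 - q)²` is also a competitor.
    have hmem : q + q - q * q ≤ q := by
      refine hq ⟨?_, ?_, ?_⟩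
      · exact add_sub_assoc q q _ ▸ add_nonneg hq0 (sub_nonneg.2 (mul_self_le_of_mem_Icc hq0 hq1))
      · have := (IsSelfAdjoint.of_nonneg (sub_nonneg.2 hq1)).mul_self_nonneg
        rw [← sub_nonneg]
        convert this using 1
        noncomm_ring
      · rw [mul_sub, mul_add, ← mul_assoc, hbq]
        simp
    rw [add_sub_assoc, add_le_iff_nonpos_right, sub_nonpos] at hmem
    exact hmem
  refine ⟨q, hproj, ?_, fun w hw hbw => ?_⟩
  · rwa [smul_mul_assoc, smul_eq_zero_iff_right (hpos b).ne'] at hbq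
  · have hle : (‖w‖ + 1)⁻¹ • w ≤ q := by
      refine hq ⟨(hscale w hw).1, (hscale w hw).2, ?_⟩
      rw [smul_mul_smul_comm, hbw, smul_zero]
    have := hproj.mul_right_and_mul_left_of_nonneg_of_le (hscale w hw).1 hle
    rw [smul_mul_assoc, mul_smul_comm] at this
    exact this.imp (fun h => smul_right_injective M (hpos w).ne' h)
      (fun h => smul_right_injective M (hpos w).ne' h)

/-- The range projection of the positive part of a self-adjoint element. -/
theorem WStarAlgebra.exists_isStarProjection_posPart {a : M} (ha : IsSelfAdjoint a) :
    ∃ e, IsStarProjection e ∧ e * a = a⁺ ∧ a * e = a⁺ := by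
  obtain ⟨q, hq, haq, hmax⟩ := WStarAlgebra.exists_isStarProjection_kernel
    (CFC.posPart_nonneg a)
  -- As `a⁺ a⁻ = 0`, the negative part lives under `q`, so `1 - q` keeps `a⁺` and kills `a⁻`.
  have hneg := hmax a⁻ (CFC.negPart_nonneg a) (CFC.posPart_mul_negPart a)
  have hqa : q * a⁺ = 0 := by
    simpa [hq.isSelfAdjoint.star_eq, (CFC.posPart_nonneg a).star_eq] using congr(star $haq)
  have hsub := CFC.posPart_sub_negPart a ha
  refine ⟨1 - q, hq.one_sub, ?_, ?_⟩
  · nth_rw 1 [← hsub]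
    rw [sub_mul, one_mul, mul_sub, hqa, hneg.2]
    abel
  · nth_rw 1 [← hsub]
    rw [mul_sub, mul_one, sub_mul, haq, hneg.1]
    abel

/-- One binary digit of `a`: `e` is the range projection of `(2a - 1)⁺`. The bounds come from `2a -
e = (2a - 1)⁺ + 2a(1 - e)` and `1 - (2a - e) = (2a - 1)⁻ + 2(1 - a)e`. -/
theorem WStarAlgebra.exists_isStarProjection_two_smul_sub_mem_Icc {a : M} (h0 : 0 ≤ a)
    (h1 : a ≤ 1) : ∃ e : M, IsStarProjection e ∧ (2 : ℝ) • a - e ∈ Icc 0 1 := by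
  have hd : IsSelfAdjoint ((2 : ℝ) • a - 1) :=
    ((IsSelfAdjoint.all (2 : ℝ)).smul (.of_nonneg h0)).sub (.one M)
  obtain ⟨e, he, hea, hae⟩ := WStarAlgebra.exists_isStarProjection_posPart hd
  have hcomm : Commute a e := by
    have h := hae.trans hea.symm
    rw [sub_mul, mul_sub, one_mul, mul_one, sub_left_inj, smul_mul_assoc, mul_smul_comm] at h
    exact smul_right_injective M (two_ne_zero (α := ℝ)) h
  have hpos := CFC.posPart_nonneg ((2 : ℝ) • a - 1)
  have hneg := CFC.negPart_nonneg ((2 : ℝ) • a - 1)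
  have hsub := CFC.posPart_sub_negPart _ hd
  rw [sub_eq_iff_eq_add, ← sub_eq_iff_eq_add'] at hsub
  rw [← hsub] at hneg
  rw [← hea] at hpos hneg
  refine ⟨e, he, ?_, ?_⟩
  · have h := ((Commute.one_right a).sub_right hcomm).mul_nonneg h0 he.one_sub_nonneg
    refine (add_nonneg hpos (smul_nonneg (zero_le_two (α := ℝ)) h)).trans_eq ?_
    rw [mul_sub, mul_sub, mul_smul_comm, mul_one, mul_one, smul_sub, hcomm.eq]
    abel
  · have h := ((Commute.one_left e).sub_left hcomm).mul_nonneg (sub_nonneg.2 h1) he.nonneg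
    rw [← sub_nonneg]
    refine (add_nonneg hneg (smul_nonneg (zero_le_two (α := ℝ)) h)).trans_eq ?_
    rw [sub_mul, mul_sub, mul_smul_comm, mul_one, one_mul, smul_sub, hcomm.eq, two_smul, two_smul,
      two_smul]
    abel

/-- Iterating the binary digit step approximates elements of `[0, 1]` within `2⁻ⁿ` by combinations
of projections; the centre is norm closed, and `[0, 1]` spans `M`. -/
theorem WStarAlgebra.mul_comm_of_projections_central
    (h : ∀ p : M, IsStarProjection p → ∀ b, p * b = b * p) (a b : M) : a * b = b * a := by
  let Z := Subalgebra.center ℂ M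
  have hclosed : IsClosed (Z : Set M) := by
    have := Set.isClosed_centralizer (univ : Set M)
    rwa [Set.centralizer_univ] at this
  have hproj : ∀ p : M, IsStarProjection p → p ∈ Z := fun p hp =>
    Subalgebra.mem_center_iff.2 fun c => (h p hp c).symm
  have happrox : ∀ n : ℕ, ∀ x : M, 0 ≤ x → x ≤ 1 → ∃ z ∈ Z, ‖x - z‖ ≤ (1 / 2) ^ n := by
    intro n
    induction n with
    | zero =>
      intro x h0 h1
      refine ⟨0, zero_mem _, ?_⟩
      simpa using (CStarAlgebra.norm_le_one_iff_of_nonneg x).2 h1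
    | succ n ih =>
      intro x h0 h1
      obtain ⟨e, he, hx0, hx1⟩ := WStarAlgebra.exists_isStarProjection_two_smul_sub_mem_Icc h0 h1
      obtain ⟨z, hz, hxz⟩ := ih _ hx0 hx1
      refine ⟨(1 / 2 : ℂ) • (e + z), Z.smul_mem (add_mem (hproj e he) hz) _, ?_⟩
      have : x - (1 / 2 : ℂ) • (e + z) = (1 / 2 : ℂ) • ((2 : ℝ) • x - e - z) := by
        rw [← Complex.coe_smul, sub_sub, smul_sub, smul_smul]
        norm_num
      rw [this, norm_smul, pow_succ']
      refine mul_le_mul (by norm_num) hxz (norm_nonneg _) (by norm_num)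
  have hIcc : ∀ x : M, 0 ≤ x → x ≤ 1 → x ∈ Z := by
    intro x h0 h1
    rw [← SetLike.mem_coe, ← hclosed.closure_eq, Metric.mem_closure_iff]
    intro ε hε
    obtain ⟨n, hn⟩ := exists_pow_lt_of_lt_one hε (show (1 / 2 : ℝ) < 1 by norm_num)
    obtain ⟨z, hz, hxz⟩ := happrox n x h0 h1
    exact ⟨z, hz, by rw [dist_eq_norm]; exact hxz.trans_lt hn⟩
  have htop : Submodule.span ℂ ({x : M | 0 ≤ x} ∩ Metric.closedBall 0 1) ≤
      Subalgebra.toSubmodule Z := by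
    refine Submodule.span_le.2 fun x hx => hIcc x hx.1 ?_
    exact (CStarAlgebra.norm_le_one_iff_of_nonneg x hx.1).1 (mem_closedBall_zero_iff.1 hx.2)
  rw [CStarAlgebra.span_nonneg_inter_unitClosedBall] at htop
  have ha : a ∈ Z := htop Submodule.mem_top
  exact (Subalgebra.mem_center_iff.1 ha b).symm

end SpectralProjections

/-! ### Order convergence in subsets of a poset. -/

section OrderConvergence

variable {P Q : Type u} [PartialOrder P] [PartialOrder Q]

theorem isClosed_orderConvergenceTopology_iff {X : Set P} :
    @IsClosed P (orderConvergenceTopology P) X ↔ IsOrderClosed X := by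
  rw [← @isOpen_compl_iff]
  change IsOrderClosed Xᶜᶜ ↔ _
  rw [compl_compl]

theorem OrderConverges.map {Γ : Type v} [Preorder Γ] [IsDirectedOrder Γ] [Nonempty Γ] {f : P → Q}
    (hf : Monotone f)
    (hsup : ∀ (T : Set P) (a : P), T.Nonempty → DirectedOn (· ≤ ·) T → IsLUB T a →
      IsLUB (f '' T) (f a))
    (hinf : ∀ (T : Set P) (a : P), T.Nonempty → DirectedOn (· ≥ ·) T → IsGLB T a →
      IsGLB (f '' T) (f a))
    {x : Γ → P} {a : P} (h : OrderConverges x a) : OrderConverges (f ∘ x) (f a) := by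
  obtain ⟨y, z, hyz, ⟨hy, hya⟩, ⟨hz, hza⟩⟩ := h
  refine ⟨f ∘ y, f ∘ z, fun γ => ⟨hf (hyz γ).1, hf (hyz γ).2⟩, ⟨hf.comp hy, ?_⟩,
    ⟨hf.comp_antitone hz, ?_⟩⟩
  · rw [range_comp]
    exact hsup _ _ (range_nonempty y) (directedOn_range.2 hy.directed_le) hya
  · rw [range_comp]
    exact hinf _ _ (range_nonempty z) (directedOn_range.2 hz.directed_ge) hza

theorem IsLUB.image_val {C : Set P} {T : Set C} {a : C} (h : IsLUB T a)
    (hs : ∃ s ∈ C, IsLUB (Subtype.val '' T) s) : IsLUB (Subtype.val '' T) (a : P) := by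
  obtain ⟨s, hsC, hs⟩ := hs
  have hle : a ≤ ⟨s, hsC⟩ := h.2 fun t ht => hs.1 ⟨t, ht, rfl⟩
  have hge : s ≤ a := hs.2 (by rintro _ ⟨t, ht, rfl⟩; exact h.1 ht)
  rwa [le_antisymm (show (a : P) ≤ s from hle) hge]

theorem IsGLB.image_val {C : Set P} {T : Set C} {a : C} (h : IsGLB T a)
    (hs : ∃ s ∈ C, IsGLB (Subtype.val '' T) s) : IsGLB (Subtype.val '' T) (a : P) := by
  obtain ⟨s, hsC, hs⟩ := hs
  have hle : ⟨s, hsC⟩ ≤ a := h.2 fun t ht => hs.1 ⟨t, ht, rfl⟩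
  have hge : a ≤ s := hs.2 (by rintro _ ⟨t, ht, rfl⟩; exact h.1 ht)
  rwa [le_antisymm hge (show s ≤ (a : P) from hle)]

theorem IsLUB.image_inclusion {C D : Set P} (hCD : C ⊆ D) {T : Set C} {a : C}
    (h : IsLUB (Subtype.val '' T) (a : P)) : IsLUB (inclusion hCD '' T) (inclusion hCD a) := by
  refine ⟨?_, fun b hb => h.2 ?_⟩
  · rintro _ ⟨t, ht, rfl⟩
    exact h.1 ⟨t, ht, rfl⟩
  · rintro _ ⟨t, ht, rfl⟩
    exact hb ⟨t, ht, rfl⟩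

theorem IsGLB.image_inclusion {C D : Set P} (hCD : C ⊆ D) {T : Set C} {a : C}
    (h : IsGLB (Subtype.val '' T) (a : P)) : IsGLB (inclusion hCD '' T) (inclusion hCD a) := by
  refine ⟨?_, fun b hb => h.2 ?_⟩
  · rintro _ ⟨t, ht, rfl⟩
    exact h.1 ⟨t, ht, rfl⟩
  · rintro _ ⟨t, ht, rfl⟩
    exact hb ⟨t, ht, rfl⟩

/-- Upward (downward) directed nonempty subsets of `C` have suprema (infima) in `P`, and these lie
in `C`. -/
def IsDirectedClosed (C : Set P) : Prop :=
  (∀ T ⊆ C, T.Nonempty → DirectedOn (· ≤ ·) T → ∃ s ∈ C, IsLUB T s) ∧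
    ∀ T ⊆ C, T.Nonempty → DirectedOn (· ≥ ·) T → ∃ s ∈ C, IsGLB T s

theorem IsDirectedClosed.isLUB_image_val {C : Set P} (hC : IsDirectedClosed C) (T : Set C) (a : C)
    (hne : T.Nonempty) (hdir : DirectedOn (· ≤ ·) T) (h : IsLUB T a) :
    IsLUB (Subtype.val '' T) (a : P) :=
  h.image_val (hC.1 _ (by simp) (hne.image _)
    (directedOn_image.2 hdir))

theorem IsDirectedClosed.isGLB_image_val {C : Set P} (hC : IsDirectedClosed C) (T : Set C) (a : C)
    (hne : T.Nonempty) (hdir : DirectedOn (· ≥ ·) T) (h : IsGLB T a) :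
    IsGLB (Subtype.val '' T) (a : P) :=
  h.image_val (hC.2 _ (by simp) (hne.image _)
    (directedOn_image.2 hdir))

theorem IsDirectedClosed.orderConverges_val {C : Set P} (hC : IsDirectedClosed C) {Γ : Type v}
    [Preorder Γ] [IsDirectedOrder Γ] [Nonempty Γ] {x : Γ → C} {a : C} (h : OrderConverges x a) :
    OrderConverges (fun γ => (x γ : P)) a :=
  h.map (Subtype.mono_coe _) hC.isLUB_image_val hC.isGLB_image_val

theorem IsDirectedClosed.orderConverges_inclusion {C D : Set P} (hC : IsDirectedClosed C)
    (hCD : C ⊆ D) {Γ : Type v} [Preorder Γ] [IsDirectedOrder Γ] [Nonempty Γ] {x : Γ → C} {a : C}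
    (h : OrderConverges x a) : OrderConverges (fun γ => inclusion hCD (x γ)) (inclusion hCD a) :=
  h.map (f := inclusion hCD) (fun _ _ h => h)
    (fun T a hne hdir h => (hC.isLUB_image_val T a hne hdir h).image_inclusion hCD)
    (fun T a hne hdir h => (hC.isGLB_image_val T a hne hdir h).image_inclusion hCD)

/-- The order topology of `C` is the trace of that of `P` as soon as order convergence of nets in
`C` means the same in `C` and in `P`. -/
theorem IsDirectedClosed.induced_eq {C : Set P} (hC : IsDirectedClosed C)
    (hconv : ∀ (Γ : Type u) [Preorder Γ] [IsDirectedOrder Γ] [Nonempty Γ] (x : Γ → C) (a : P),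
      OrderConverges (fun γ => (x γ : P)) a → ∃ ha : a ∈ C, OrderConverges x ⟨a, ha⟩) :
    (orderConvergenceTopology P).induced (Subtype.val : C → P) = orderConvergenceTopology C := by
  refine TopologicalSpace.ext_iff_isClosed.2 fun X => ?_
  rw [isClosed_orderConvergenceTopology_iff, @isClosed_induced_iff]
  simp only [isClosed_orderConvergenceTopology_iff]
  constructor
  · rintro ⟨Y, hY, rfl⟩ Γ _ _ _ x a hx h
    exact hY Γ _ _ hx (hC.orderConverges_val h)
  · intro hX
    refine ⟨Subtype.val '' X, ?_, preimage_image_eq _ Subtype.val_injective⟩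
    intro Γ _ _ _ x a hx h
    choose x' hx' hxx' using hx
    obtain rfl : (fun γ => (x' γ : P)) = x := funext hxx'
    obtain ⟨ha, h⟩ := hconv Γ x' a h
    exact ⟨⟨a, ha⟩, hX Γ x' _ hx' h, rfl⟩

theorem isLUB_range_sup {Γ : Type v} {y s : Γ → P} {l a b : P}
    (hs : ∀ γ, IsLUB {y γ, l} (s γ)) (ha : IsLUB (range y) a) (hb : IsLUB {a, l} b) [Nonempty Γ] :
    IsLUB (range s) b := by
  constructor
  · rintro _ ⟨γ, rfl⟩
    refine (hs γ).2 ?_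
    rintro _ (rfl | rfl)
    · exact (ha.1 (mem_range_self γ)).trans (hb.1 (by simp))
    · exact hb.1 (by simp)
  · intro c hc
    refine hb.2 ?_
    have hc' : ∀ γ, y γ ≤ c ∧ l ≤ c := fun γ =>
      ⟨((hs γ).1 (by simp)).trans (hc (mem_range_self γ)),
        ((hs γ).1 (by simp)).trans (hc (mem_range_self γ))⟩
    rintro _ (rfl | rfl)
    · refine ha.2 ?_
      rintro _ ⟨γ, rfl⟩
      exact (hc' γ).1
    · exact (hc' (Classical.arbitrary Γ)).2

theorem isGLB_range_inf {Γ : Type v} {y s : Γ → P} {l a b : P}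
    (hs : ∀ γ, IsGLB {y γ, l} (s γ)) (ha : IsGLB (range y) a) (hb : IsGLB {a, l} b) [Nonempty Γ] :
    IsGLB (range s) b :=
  isLUB_range_sup (P := Pᵒᵈ) hs ha hb

/-- Order convergence in `P` of nets in an interval `Icc l u` can be witnessed inside the interval
when joins with `l` and meets with `u` exist. -/
theorem OrderConverges.of_val_Icc {l u : P} (hsup : ∀ x, ∃ s, IsLUB {x, l} s)
    (hinf : ∀ x, ∃ s, IsGLB {x, u} s) {Γ : Type v} [Preorder Γ] [Nonempty Γ] {x : Γ → Icc l u}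
    {a : P} (h : OrderConverges (fun γ => (x γ : P)) a) :
    ∃ ha : a ∈ Icc l u, OrderConverges x ⟨a, ha⟩ := by
  obtain ⟨y, z, hyz, ⟨hy, hya⟩, ⟨hz, hza⟩⟩ := h
  have ha : a ∈ Icc l u := by
    refine ⟨hza.2 ?_, hya.2 ?_⟩
    · rintro _ ⟨γ, rfl⟩
      exact (x γ).2.1.trans (hyz γ).2
    · rintro _ ⟨γ, rfl⟩
      exact (hyz γ).1.trans (x γ).2.2
  -- Replace `y` by `y ∨ l` and `z` by `z ∧ u`; since `l ≤ a ≤ u`, the limits do not move.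
  choose s hs using fun γ => hsup (y γ)
  choose t ht using fun γ => hinf (z γ)
  have hsa : IsLUB (range s) a := isLUB_range_sup hs hya
    ⟨by rintro _ (rfl | rfl); exacts [le_rfl, ha.1], fun b hb => hb (by simp)⟩
  have hta : IsGLB (range t) a := isGLB_range_inf ht hza
    ⟨by rintro _ (rfl | rfl); exacts [le_rfl, ha.2], fun b hb => hb (by simp)⟩
  have hsl : ∀ γ, l ≤ s γ := fun γ => (hs γ).1 (by simp)
  have htu : ∀ γ, t γ ≤ u := fun γ => (ht γ).1 (by simp)
  have hsx : ∀ γ, s γ ≤ x γ := fun γ => (hs γ).2 (by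
    rintro _ (rfl | rfl); exacts [(hyz γ).1, (x γ).2.1])
  have hxt : ∀ γ, x γ ≤ t γ := fun γ => (ht γ).2 (by
    rintro _ (rfl | rfl); exacts [(hyz γ).2, (x γ).2.2])
  refine ⟨ha, fun γ => ⟨s γ, hsl γ, (hsx γ).trans (x γ).2.2⟩,
    fun γ => ⟨t γ, (x γ).2.1.trans (hxt γ), htu γ⟩, fun γ => ⟨hsx γ, hxt γ⟩, ⟨?_, ?_⟩, ⟨?_, ?_⟩⟩
  · intro γ δ h
    refine (hs γ).2 ?_
    rintro _ (rfl | rfl)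
    exacts [(hy h).trans ((hs δ).1 (by simp)), hsl δ]
  · refine ⟨?_, fun b hb => hsa.2 ?_⟩
    · rintro _ ⟨γ, rfl⟩
      exact hsa.1 ⟨γ, rfl⟩
    · rintro _ ⟨γ, rfl⟩
      exact hb ⟨γ, rfl⟩
  · intro γ δ h
    refine (ht γ).2 ?_
    rintro _ (rfl | rfl)
    exacts [((ht δ).1 (by simp)).trans (hz h), htu δ]
  · refine ⟨?_, fun b hb => hta.2 ?_⟩
    · rintro _ ⟨γ, rfl⟩
      exact hta.1 ⟨γ, rfl⟩
    · rintro _ ⟨γ, rfl⟩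
      exact hb ⟨γ, rfl⟩

/-- A net in the range of a sequence that order converges outside the range visits infinitely many
terms after every index. -/
theorem OrderConverges.frequently_of_mem_range {q : ℕ → P} {Γ : Type v} [Preorder Γ]
    [IsDirectedOrder Γ] {y x z : Γ → P} {a : P} (hyz : ∀ γ, y γ ≤ x γ ∧ x γ ≤ z γ)
    (hy : Monotone y) (hya : IsLUB (range y) a) (hz : Antitone z) (hza : IsGLB (range z) a)
    (hx : ∀ γ, x γ ∈ range q) (ha : a ∉ range q) (γ : Γ) :
    ∃ᶠ m in Filter.atTop, y γ ≤ q m ∧ q m ≤ z γ := by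
  -- A value taken cofinally would lie below every `z γ` and above every `y γ`, hence equal `a`.
  have hev : ∀ n, ∃ γ', ∀ δ, γ' ≤ δ → x δ ≠ q n := by
    intro n
    by_contra! hcon
    refine ha ⟨n, le_antisymm (hza.2 ?_) (hya.2 ?_)⟩
    · rintro _ ⟨γ, rfl⟩
      obtain ⟨δ, hδ, h⟩ := hcon γ
      exact h ▸ (hyz δ).2.trans (hz hδ)
    · rintro _ ⟨γ, rfl⟩
      obtain ⟨δ, hδ, h⟩ := hcon γ
      exact h ▸ (hy hδ).trans (hyz δ).1
  have hbelow : ∀ n, ∃ γ', γ ≤ γ' ∧ ∀ m < n, ∀ δ, γ' ≤ δ → x δ ≠ q m := by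
    intro n
    induction n with
    | zero => exact ⟨γ, le_rfl, by simp⟩
    | succ n ih =>
      obtain ⟨γ₁, h₁, h₁'⟩ := ih
      obtain ⟨γ₂, h₂⟩ := hev n
      obtain ⟨γ₃, h₁₃, h₂₃⟩ := exists_ge_ge γ₁ γ₂
      refine ⟨γ₃, h₁.trans h₁₃, fun m hm δ hδ => ?_⟩
      rcases Nat.lt_succ_iff_lt_or_eq.1 hm with hm | rfl
      exacts [h₁' m hm δ (h₁₃.trans hδ), h₂ δ (h₂₃.trans hδ)]
  rw [Filter.frequently_atTop]
  intro n
  obtain ⟨γ', h, h'⟩ := hbelow n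
  obtain ⟨m, hm⟩ := hx γ'
  exact ⟨m, not_lt.1 fun hmn => h' m hmn γ' le_rfl hm.symm,
    hm ▸ (hy h).trans (hyz γ').1, hm ▸ (hyz γ').2.trans (hz h)⟩

end OrderConvergence

/-! ### Directed completeness of intervals and of the projections. -/

section DirectedClosed

variable {M : Type u} [CStarAlgebra M] [PartialOrder M]

theorem selfAdjoint.isLUB_of_image_val {T : Set (selfAdjoint M)} {s : selfAdjoint M}
    (h : IsLUB (Subtype.val '' T) (s : M)) : IsLUB T s :=
  h.of_image (f := Subtype.val) Iff.rfl

theorem selfAdjoint.isGLB_of_image_val {T : Set (selfAdjoint M)} {s : selfAdjoint M}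
    (h : IsGLB (Subtype.val '' T) (s : M)) : IsGLB T s :=
  h.of_image (f := Subtype.val) Iff.rfl

variable [StarOrderedRing M]

theorem mem_selfAdjointUnitBall_iff {x : selfAdjoint M} :
    x ∈ selfAdjointUnitBall M ↔ x ∈ Icc (-1) 1 := by
  have := IsSelfAdjoint.norm_le_iff_mem_Icc x.2 zero_le_one
  rw [map_one] at this
  exact this

theorem selfAdjointUnitBall_eq_Icc : selfAdjointUnitBall M = Icc (-1) 1 :=
  Set.ext fun _ => mem_selfAdjointUnitBall_iff

variable [WStarAlgebra M]

theorem selfAdjoint.exists_isLUB {T : Set (selfAdjoint M)} (hne : T.Nonempty)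
    (hdir : DirectedOn (· ≤ ·) T) (hbdd : BddAbove T) :
    ∃ s : selfAdjoint M, IsLUB (Subtype.val '' T) (s : M) := by
  obtain ⟨s, hs⟩ := WStarAlgebra.exists_isLUB (hne.image Subtype.val) (directedOn_image.2 hdir)
    (Monotone.map_bddAbove (Subtype.mono_coe _) hbdd)
  obtain ⟨t, ht⟩ := hne
  exact ⟨⟨s, .of_ge (hs.1 ⟨t, ht, rfl⟩) t.2⟩, hs⟩

theorem selfAdjoint.exists_isGLB {T : Set (selfAdjoint M)} (hne : T.Nonempty)
    (hdir : DirectedOn (· ≥ ·) T) (hbdd : BddBelow T) :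
    ∃ s : selfAdjoint M, IsGLB (Subtype.val '' T) (s : M) := by
  obtain ⟨s, hs⟩ := WStarAlgebra.exists_isGLB (hne.image Subtype.val) (directedOn_image.2 hdir)
    (Monotone.map_bddBelow (Subtype.mono_coe _) hbdd)
  obtain ⟨t, ht⟩ := hne
  exact ⟨⟨s, (IsSelfAdjoint.iff_of_le (hs.1 ⟨t, ht, rfl⟩)).2 t.2⟩, hs⟩

theorem selfAdjoint.isDirectedClosed_Icc (l u : selfAdjoint M) : IsDirectedClosed (Icc l u) := by
  constructor
  · intro T hT hne hdir
    obtain ⟨s, hs⟩ := exists_isLUB hne hdir ⟨u, fun t ht => (hT ht).2⟩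
    replace hs := isLUB_of_image_val hs
    obtain ⟨t, ht⟩ := hne
    exact ⟨s, ⟨(hT ht).1.trans (hs.1 ht), hs.2 fun t ht => (hT ht).2⟩, hs⟩
  · intro T hT hne hdir
    obtain ⟨s, hs⟩ := exists_isGLB hne hdir ⟨l, fun t ht => (hT ht).1⟩
    replace hs := isGLB_of_image_val hs
    obtain ⟨t, ht⟩ := hne
    exact ⟨s, ⟨hs.2 fun t ht => (hT ht).1, (hs.1 ht).trans (hT ht).2⟩, hs⟩

variable (M) in
theorem isDirectedClosed_projectionSet : IsDirectedClosed (projectionSet M) := by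
  constructor
  · intro T hT hne hdir
    obtain ⟨s, hs⟩ := selfAdjoint.exists_isLUB hne hdir
      ⟨1, fun t ht => IsStarProjection.le_one (hT ht : IsStarProjection (t : M))⟩
    refine ⟨s, hs.isStarProjection (hne.image _) ?_, selfAdjoint.isLUB_of_image_val hs⟩
    rintro _ ⟨t, ht, rfl⟩
    exact hT ht
  · intro T hT hne hdir
    obtain ⟨s, hs⟩ := selfAdjoint.exists_isGLB hne hdir
      ⟨0, fun t ht => IsStarProjection.nonneg (hT ht : IsStarProjection (t : M))⟩
    refine ⟨s, hs.isStarProjection (hne.image _) ?_, selfAdjoint.isGLB_of_image_val hs⟩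
    rintro _ ⟨t, ht, rfl⟩
    exact hT ht

end DirectedClosed

/-! ### The abelian case. -/

section Commutative

variable {M : Type u} [CStarAlgebra M] [PartialOrder M] [StarOrderedRing M] [WStarAlgebra M]

theorem isLUB_pair_add_posPart (hM : ∀ a b : M, a * b = b * a) {a b : M} (ha : IsSelfAdjoint a)
    (hb : IsSelfAdjoint b) : IsLUB {a, b} (b + (a - b)⁺) := by
  have hab := ha.sub hb
  obtain ⟨e, he, hea, -⟩ := WStarAlgebra.exists_isStarProjection_posPart hab
  constructor
  · rintro _ (rfl | rfl)
    · exact sub_le_iff_le_add'.1 (CFC.le_posPart hab)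
    · exact le_add_of_nonneg_right (CFC.posPart_nonneg _)
  · intro c hc
    have h1 : 0 ≤ e * (c - a) :=
      Commute.mul_nonneg he.nonneg (sub_nonneg.2 (hc (by simp))) (hM _ _)
    have h2 : 0 ≤ (1 - e) * (c - b) :=
      Commute.mul_nonneg he.one_sub_nonneg (sub_nonneg.2 (hc (by simp))) (hM _ _)
    rw [← sub_nonneg, ← hea]
    -- With `e (a - b) = (a - b)⁺`, one has `c - b - (a - b)⁺ = e(c - a) + (1 - e)(c - b)`.
    convert add_nonneg h1 h2 using 1
    noncomm_ring

theorem selfAdjoint.exists_isLUB_pair (hM : ∀ a b : M, a * b = b * a) (a b : selfAdjoint M) :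
    ∃ s, IsLUB {a, b} s := by
  refine ⟨⟨b + ((a : M) - b)⁺, b.2.add (.of_nonneg (CFC.posPart_nonneg _))⟩,
    isLUB_of_image_val ?_⟩
  rw [image_pair]
  exact isLUB_pair_add_posPart hM a.2 b.2

theorem selfAdjoint.exists_isGLB_pair (hM : ∀ a b : M, a * b = b * a) (a b : selfAdjoint M) :
    ∃ s, IsGLB {a, b} s := by
  obtain ⟨s, hs⟩ := exists_isLUB_pair hM (-a) (-b)
  refine ⟨-s, ?_⟩
  have := isGLB_neg'.2 (show IsLUB (-{a, b}) (- -s) by simpa using hs)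
  simpa using this

/-- Finite products of members of `T` form a downward directed family with the same lower bounds, by
`pq - b = p(q - b) + (1 - p)(p - b)`. The infimum is taken in all of `M`, so it can be compared with
bounds that are not projections. -/
theorem exists_isGLB_of_isStarProjection (hM : ∀ a b : M, a * b = b * a) {T : Set M}
    (hne : T.Nonempty) (hT : ∀ p ∈ T, IsStarProjection p) :
    ∃ s, IsStarProjection s ∧ IsGLB T s := by
  have hcl : ∀ p ∈ Submonoid.closure T, IsStarProjection p ∧ p ∈ upperBounds (lowerBounds T) := by
    intro p hp
    induction hp using Submonoid.closure_induction with
    | mem p hp => exact ⟨hT p hp, fun b hb => hb hp⟩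
    | one =>
      obtain ⟨t, ht⟩ := hne
      exact ⟨.one M, fun b hb => (hb ht).trans (hT t ht).le_one⟩
    | mul p q _ _ hp hq =>
      refine ⟨hp.1.mul hq.1 (hM p q), fun b hb => ?_⟩
      have h1 : 0 ≤ p * (q - b) :=
        Commute.mul_nonneg hp.1.nonneg (sub_nonneg.2 (hq.2 hb)) (hM _ _)
      have h2 : 0 ≤ (1 - p) * (p - b) :=
        Commute.mul_nonneg hp.1.one_sub_nonneg (sub_nonneg.2 (hp.2 hb)) (hM _ _)
      rw [← sub_nonneg]
      convert add_nonneg h1 h2 using 1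
      rw [mul_sub (1 - p), hp.1.one_sub_mul_self]
      noncomm_ring
  have hdir : DirectedOn (· ≥ ·) (Submonoid.closure T : Set M) := by
    intro p hp q hq
    refine ⟨p * q, mul_mem hp hq, ?_, ?_⟩
    · have := Commute.mul_nonneg (hcl p hp).1.nonneg (hcl q hq).1.one_sub_nonneg (hM _ _)
      rwa [mul_sub, mul_one, sub_nonneg] at this
    · have := Commute.mul_nonneg (hcl p hp).1.one_sub_nonneg (hcl q hq).1.nonneg (hM _ _)
      rwa [sub_mul, one_mul, sub_nonneg] at this
  obtain ⟨s, hs⟩ := WStarAlgebra.exists_isGLB ⟨1, one_mem _⟩ hdir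
    ⟨0, fun p hp => (hcl p hp).1.nonneg⟩
  exact ⟨s, hs.isStarProjection ⟨1, one_mem _⟩ fun p hp => (hcl p hp).1,
    fun t ht => hs.1 (Submonoid.subset_closure ht), fun b hb => hs.2 fun p hp => (hcl p hp).2 hb⟩

theorem exists_isLUB_of_isStarProjection (hM : ∀ a b : M, a * b = b * a) {T : Set M}
    (hne : T.Nonempty) (hT : ∀ p ∈ T, IsStarProjection p) :
    ∃ s, IsStarProjection s ∧ IsLUB T s := by
  obtain ⟨s, hs, hsT⟩ := exists_isGLB_of_isStarProjection hM (hne.image (1 - ·)) (by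
    rintro _ ⟨p, hp, rfl⟩
    exact (hT p hp).one_sub)
  have := isLUB_image_one_sub.2 hsT
  simp only [image_image, sub_sub_cancel, image_id'] at this
  exact ⟨1 - s, hs.one_sub, this⟩

/-- In the commutative case, order convergence of projections in the self-adjoint part can be
witnessed by projections. -/
theorem OrderConverges.of_val_projectionSet (hM : ∀ a b : M, a * b = b * a) {Γ : Type v}
    [Preorder Γ] [IsDirectedOrder Γ] [Nonempty Γ] {x : Γ → projectionSet M} {a : selfAdjoint M}
    (h : OrderConverges (fun γ => (x γ : selfAdjoint M)) a) :
    ∃ ha : a ∈ projectionSet M, OrderConverges x ⟨a, ha⟩ := by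
  obtain ⟨y, z, hyz, ⟨hy, hya⟩, ⟨hz, hza⟩⟩ := h
  let tail : Γ → Set M := fun γ => (fun δ => ((x δ : selfAdjoint M) : M)) '' Ici γ
  have htail : ∀ γ, (tail γ).Nonempty := fun γ => nonempty_Ici.image _
  have hproj : ∀ γ, ∀ p ∈ tail γ, IsStarProjection p := by
    rintro γ _ ⟨δ, -, rfl⟩
    exact (x δ).2
  -- Tail infima and suprema of `x` lie between `y` and `z`, because `y γ ≤ x δ ≤ z γ` for all `δ ≥
  -- γ`.
  choose p hp hpx using fun γ => exists_isGLB_of_isStarProjection hM (htail γ) (hproj γ)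
  choose q hq hqx using fun γ => exists_isLUB_of_isStarProjection hM (htail γ) (hproj γ)
  let p' : Γ → projectionSet M := fun γ => ⟨⟨p γ, (hp γ).isSelfAdjoint⟩, hp γ⟩
  let q' : Γ → projectionSet M := fun γ => ⟨⟨q γ, (hq γ).isSelfAdjoint⟩, hq γ⟩
  have hsub : ∀ {γ δ}, γ ≤ δ → tail δ ⊆ tail γ := fun h => image_mono (Ici_subset_Ici.2 h)
  have hpx' : ∀ γ δ, γ ≤ δ → (p' γ : selfAdjoint M) ≤ x δ := fun γ δ h => (hpx γ).1 ⟨δ, h, rfl⟩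
  have hqx' : ∀ γ δ, γ ≤ δ → (x δ : selfAdjoint M) ≤ q' γ := fun γ δ h => (hqx γ).1 ⟨δ, h, rfl⟩
  have hyp : ∀ γ, y γ ≤ p' γ := by
    refine fun γ => (hpx γ).2 ?_
    rintro _ ⟨δ, hδ, rfl⟩
    exact (hy hδ).trans (hyz δ).1
  have hqz : ∀ γ, (q' γ : selfAdjoint M) ≤ z γ := by
    refine fun γ => (hqx γ).2 ?_
    rintro _ ⟨δ, hδ, rfl⟩
    exact (hyz δ).2.trans (hz hδ)
  have hpa : ∀ γ, (p' γ : selfAdjoint M) ≤ a := by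
    refine fun γ => hza.2 ?_
    rintro _ ⟨δ, rfl⟩
    obtain ⟨ε, h, h'⟩ := exists_ge_ge γ δ
    exact (hpx' γ ε h).trans ((hyz ε).2.trans (hz h'))
  have haq : ∀ γ, a ≤ (q' γ : selfAdjoint M) := by
    refine fun γ => hya.2 ?_
    rintro _ ⟨δ, rfl⟩
    obtain ⟨ε, h, h'⟩ := exists_ge_ge γ δ
    exact ((hy h').trans (hyz ε).1).trans (hqx' γ ε h)
  have hleast : ∀ b : selfAdjoint M, (∀ γ, (p' γ : selfAdjoint M) ≤ b) → a ≤ b := by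
    intro b hb
    refine hya.2 ?_
    rintro _ ⟨γ, rfl⟩
    exact (hyp γ).trans (hb γ)
  have hgreatest : ∀ b : selfAdjoint M, (∀ γ, b ≤ (q' γ : selfAdjoint M)) → b ≤ a := by
    intro b hb
    refine hza.2 ?_
    rintro _ ⟨γ, rfl⟩
    exact (hb γ).trans (hqz γ)
  have hpmono : Monotone p' := fun γ δ h => (hpx δ).2 fun t ht => (hpx γ).1 (hsub h ht)
  have hqanti : Antitone q' := fun γ δ h => (hqx δ).2 fun t ht => (hqx γ).1 (hsub h ht)
  have ha : a ∈ projectionSet M := by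
    obtain ⟨s, hs, hsp⟩ := (isDirectedClosed_projectionSet M).1
      (range fun γ => (p' γ : selfAdjoint M)) (range_subset_iff.2 fun γ => (p' γ).2)
      (range_nonempty _) (directedOn_range.2 (Monotone.directed_le fun _ _ h => hpmono h))
    have : IsLUB (range fun γ => (p' γ : selfAdjoint M)) a :=
      ⟨forall_mem_range.2 hpa, fun b hb => hleast b fun γ => hb (mem_range_self γ)⟩
    rwa [this.unique hsp]
  refine ⟨ha, p', q', fun γ => ⟨hpx' γ γ le_rfl, hqx' γ γ le_rfl⟩,
    ⟨hpmono, forall_mem_range.2 hpa, fun b hb => hleast b fun γ => hb (mem_range_self γ)⟩,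
    ⟨hqanti, forall_mem_range.2 haq, fun b hb => hgreatest b fun γ => hb (mem_range_self γ)⟩⟩

variable (M) in
theorem induced_val_projectionSet_eq (hM : ∀ a b : M, a * b = b * a) :
    (orderConvergenceTopology (selfAdjoint M)).induced
        (Subtype.val : projectionSet M → selfAdjoint M) =
      orderConvergenceTopology (projectionSet M) :=
  (isDirectedClosed_projectionSet M).induced_eq fun _ _ _ _ _ _ h => h.of_val_projectionSet hM

variable (M) in
theorem induced_val_selfAdjointUnitBall_eq (hM : ∀ a b : M, a * b = b * a) :
    (orderConvergenceTopology (selfAdjoint M)).induced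
        (Subtype.val : selfAdjointUnitBall M → selfAdjoint M) =
      orderConvergenceTopology (selfAdjointUnitBall M) := by
  rw [selfAdjointUnitBall_eq_Icc]
  exact (selfAdjoint.isDirectedClosed_Icc _ _).induced_eq fun _ _ _ _ _ _ h =>
    h.of_val_Icc (fun x => selfAdjoint.exists_isLUB_pair hM x _)
      (fun x => selfAdjoint.exists_isGLB_pair hM x _)

end Commutative

/-! ### Norm limits in order closed sets. -/

section NormClosed

variable {M : Type u} [CStarAlgebra M] [PartialOrder M] [StarOrderedRing M]

/-- Order closed subsets of the self-adjoint part contain the norm limits of their sequences. -/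
theorem IsOrderClosed.mem_of_tendsto {Y : Set (selfAdjoint M)} (hY : IsOrderClosed Y)
    {x : ℕ → selfAdjoint M} {a : selfAdjoint M} (hx : ∀ n, x n ∈ Y)
    (h : Filter.Tendsto (fun n => (x n : M)) Filter.atTop (nhds (a : M))) : a ∈ Y := by
  have hex : ∀ n : ℕ, ∃ m, ‖(x m : M) - a‖ ≤ 1 / ((n : ℝ) + 1) := by
    intro n
    have := (tendsto_iff_norm_sub_tendsto_zero.1 h).eventually
      (ge_mem_nhds (show (0 : ℝ) < 1 / ((n : ℝ) + 1) by positivity))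
    exact this.exists
  choose m hm using hex
  -- The bounding sequences will be `a ± r n`, which need not stay in the unit ball.
  let r : ℕ → selfAdjoint M := fun n =>
    ⟨algebraMap ℝ M (1 / ((n : ℝ) + 1)), (IsSelfAdjoint.all _).algebraMap M⟩
  have hr : Antitone r := fun n k h =>
    algebraMap_mono M (show 1 / ((k : ℝ) + 1) ≤ 1 / ((n : ℝ) + 1) from Nat.one_div_le_one_div h)
  have hlim : Filter.Tendsto (fun n => (r n : M)) Filter.atTop (nhds 0) := by
    rw [← map_zero (algebraMap ℝ M)]
    exact ((continuous_algebraMap ℝ M).tendsto 0).comp tendsto_one_div_add_atTop_nhds_zero_nat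
  have hbd : ∀ n, (x (m n) : M) - a ∈ Icc (-(r n : M)) (r n) := fun n =>
    (IsSelfAdjoint.norm_le_iff_mem_Icc ((x (m n)).2.sub a.2) (by positivity)).1 (hm n)
  have hr0 : ∀ n, 0 ≤ r n := fun n =>
    algebraMap_nonneg M (show 0 ≤ 1 / ((n : ℝ) + 1) by positivity)
  refine hY.mem_of_orderConverges (x := fun n => x (m n)) (fun n => hx _)
    ⟨fun n => a - r n, fun n => a + r n, fun n => ⟨?_, ?_⟩, ⟨fun n k h => ?_, ?_, ?_⟩,
      ⟨fun n k h => ?_, ?_, ?_⟩⟩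
  · have := (hbd n).1
    rw [le_sub_iff_add_le, neg_add_eq_sub] at this
    exact this
  · exact (sub_le_iff_le_add'.1 (hbd n).2 :)
  · exact sub_le_sub_left (hr h) a
  · rintro _ ⟨n, rfl⟩
    exact sub_le_self a (hr0 n)
  · intro b hb
    refine le_of_tendsto' (x := Filter.atTop) (f := fun n => (a : M) - r n)
      (by simpa using hlim.const_sub (a : M)) fun n => hb (mem_range_self n)
  · exact add_le_add_right (hr h) a
  · rintro _ ⟨n, rfl⟩
    exact le_add_of_nonneg_right (hr0 n)
  · intro b hb
    refine ge_of_tendsto' (x := Filter.atTop) (f := fun n => (a : M) + r n)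
      (by simpa using hlim.const_add (a : M)) fun n => hb (mem_range_self n)

end NormClosed

/-! ### Curves through a noncentral projection. -/

section Noncentral

variable {M : Type u} [CStarAlgebra M]

/-- Vanishing at both `b` and `star b` would give `p b = p b p = b p`. -/
theorem IsStarProjection.exists_mul_mul_one_sub_ne_zero {p : M} (hp : IsStarProjection p)
    (h : ∃ b, p * b ≠ b * p) : ∃ b, p * b * (1 - p) ≠ 0 := by
  by_contra! hcon
  obtain ⟨b, hb⟩ := h
  refine hb ?_
  have h1 : p * b = p * b * p := by
    have := hcon b
    rwa [mul_sub, mul_one, sub_eq_zero] at this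
  have h2 : p * star b = p * star b * p := by
    have := hcon (star b)
    rwa [mul_sub, mul_one, sub_eq_zero] at this
  have h3 : b * p = p * b * p := by
    simpa [hp.isSelfAdjoint.star_eq, mul_assoc] using congr(star $h2)
  rw [h1, h3]

open NormedSpace in
/-- A noncentral projection is the limit of a curve of projections with nonzero derivative. -/
theorem IsStarProjection.exists_hasDerivAt {p : M} (hp : IsStarProjection p) {b : M} :
    ∃ f : ℝ → M, f 0 = p ∧ (∀ t, IsStarProjection (f t)) ∧
      HasDerivAt f (-(p * b * (1 - p) + star (p * b * (1 - p)))) 0 := by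
  set x := p * b * (1 - p) with hx
  set h := x - star x with hh
  have hpx : p * x = x := by
    rw [hx, ← mul_assoc, ← mul_assoc, hp.isIdempotentElem.eq]
  have hxp : x * p = 0 := by rw [hx, mul_assoc, hp.one_sub_mul_self, mul_zero]
  have hpx' : p * star x = 0 := by
    simpa [hp.isSelfAdjoint.star_eq] using congr(star $hxp)
  have hxp' : star x * p = star x := by
    simpa [hp.isSelfAdjoint.star_eq] using congr(star $hpx)
  have hskew : h ∈ skewAdjoint M := by
    rw [skewAdjoint.mem_iff, hh]; simp
  let _ : NormedAlgebra ℚ M := .restrictScalars ℚ ℂ M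
  have hunit : ∀ t : ℝ, exp (t • h) ∈ unitary M := fun t =>
    exp_mem_unitary_of_mem_skewAdjoint (skewAdjoint.smul_mem t hskew)
  have hstar : ∀ t : ℝ, star (exp (t • h)) = exp (t • (-h)) := by
    intro t
    rw [star_exp, star_smul, skewAdjoint.mem_iff.1 hskew]
    simp
  -- Unitary conjugates of `p`; the derivative at `0` is `h p - p h = -(x + x⋆)`, as `p x = x` and
  -- `x p = 0`.
  refine ⟨fun t => exp (t • h) * p * star (exp (t • h)), by simp, fun t => ?_, ?_⟩
  · constructor
    · change _ * _ = _
      calc exp (t • h) * p * star (exp (t • h)) * (exp (t • h) * p * star (exp (t • h)))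
          = exp (t • h) * p * (star (exp (t • h)) * exp (t • h)) * p * star (exp (t • h)) := by
            simp only [mul_assoc]
        _ = exp (t • h) * p * star (exp (t • h)) := by
            rw [Unitary.star_mul_self_of_mem (hunit t), mul_one, mul_assoc (exp (t • h)),
              hp.isIdempotentElem.eq]
    · exact hp.isSelfAdjoint.conjugate _
  · simp only [hstar]
    have h1 := ((hasDerivAt_exp_smul_const (𝕂 := ℝ) h 0).mul_const p).mul
      (hasDerivAt_exp_smul_const (𝕂 := ℝ) (-h) 0)
    refine h1.congr_deriv ?_
    simp only [zero_smul, exp_zero, one_mul, mul_one, hh, sub_mul, mul_neg, mul_sub, hxp, hpx,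
      hpx', hxp']
    abel

end Noncentral

/-! ### An order closed sequence in the unit ball with norm limit outside it. -/

section NotClosed

variable {M : Type u} [CStarAlgebra M] [PartialOrder M] [StarOrderedRing M]

/-- An element `z ≤ 1` above infinitely many terms of a sequence of projections approaching `p`
along a curve with derivative `-(x + x⋆)` dominates more than `p`. -/
theorem add_smul_star_mul_self_le {p x z : M} (hp : IsStarProjection p) (hpx : p * x = x)
    (hxp : x * p = 0) {q : ℕ → M} {t : ℕ → ℝ} (hq : ∀ n, IsStarProjection (q n))
    (hlim : Filter.Tendsto q Filter.atTop (nhds p))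
    (hder : Filter.Tendsto (fun n => t n • (q n - p)) Filter.atTop (nhds (-(x + star x))))
    (hz : z ≤ 1) (hfreq : ∃ᶠ m in Filter.atTop, q m ≤ z) {r : ℝ} (hr : 0 ≤ r)
    (hrx : r • (star x * x) ≤ 1) :
    p + r • (star x * x) ≤ z ∧ p + r • (star x * x) ≤ 1 := by
  have hpz : p ≤ z := le_of_tendsto_of_frequently hlim hfreq
  have hzp := hp.mul_eq_of_le hpz hz
  have hclosed : IsClosed {v : M | (1 - z) * v = 0} :=
    isClosed_eq (continuous_const.mul continuous_id) continuous_const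
  -- `1 - z` annihilates `p` and infinitely many `q m`, hence their difference quotients and the
  -- limit of these.
  have hw : (1 - z) * (-(x + star x)) = 0 := by
    refine hclosed.mem_of_frequently_of_tendsto (hfreq.mono fun m hm => ?_) hder
    have := (hq m).mul_eq_of_le hm hz
    change (1 - z) * (t m • (q m - p)) = 0
    rw [mul_smul_comm, mul_sub, sub_mul, sub_mul, this.1, hzp.1]
    simp
  have hzx : z * x = x := by rw [← hpx, ← mul_assoc, hzp.1]
  have hzx' : z * star x = star x := by
    rw [mul_neg, mul_add, sub_mul, sub_mul, hzx, one_mul, one_mul, sub_self, zero_add,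
      neg_eq_zero, sub_eq_zero] at hw
    exact hw.symm
  have hpx' : p * star x = 0 := by
    simpa [hp.isSelfAdjoint.star_eq] using congr(star $hxp)
  set c := r • (star x * x) with hc
  have hc0 : 0 ≤ c := smul_nonneg hr (star_mul_self_nonneg x)
  have hcp : c * p = 0 := by rw [hc, smul_mul_assoc, mul_assoc, hxp, mul_zero, smul_zero]
  have hpc : p * c = 0 := by rw [hc, mul_smul_comm, ← mul_assoc, hpx', zero_mul, smul_zero]
  have hpc1 : p + c ≤ 1 := by
    -- Since `c` is orthogonal to `p`, `(1 - p)(1 - c)(1 - p) = 1 - p - c`.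
    have := hp.one_sub.isSelfAdjoint.conjugate_nonneg (sub_nonneg.2 hrx)
    rw [← sub_nonneg]
    convert this using 1
    have h2 := hp.isIdempotentElem.eq
    simp only [mul_sub, sub_mul, mul_one, one_mul, hcp, hpc, h2, zero_mul]
    abel
  have hz0 : 0 ≤ z := hp.nonneg.trans hpz
  have hzc : z * (p + c) = p + c := by
    rw [mul_add, hzp.1, hc, mul_smul_comm, ← mul_assoc, hzx']
  have hcz : (p + c) * z = p + c := by
    simpa [hz0.star_eq, hc0.star_eq, hp.isSelfAdjoint.star_eq] using congr(star $hzc)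
  refine ⟨?_, hpc1⟩
  -- `z` fixes `p + c`, so `z - (p + c) = z (1 - (p + c))` is a product of commuting positive
  -- elements.
  have := Commute.mul_nonneg hz0 (sub_nonneg.2 hpc1)
    ((Commute.one_right z).sub_right (hzc.trans hcz.symm))
  rwa [mul_sub, mul_one, hzc, sub_nonneg] at this

theorem exists_isOrderClosed_range_inclusion {p : M} (hp : IsStarProjection p)
    (h : ∃ b, p * b ≠ b * p) :
    ∃ q : ℕ → projectionSet M,
      Filter.Tendsto (fun n => ((q n : selfAdjoint M) : M)) Filter.atTop (nhds p) ∧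
      (∀ n, ((q n : selfAdjoint M) : M) ≠ p) ∧
      IsOrderClosed (range fun n =>
        inclusion (projectionSet_subset_selfAdjointUnitBall M) (q n)) := by
  obtain ⟨b, hb⟩ := hp.exists_mul_mul_one_sub_ne_zero h
  obtain ⟨f, hf0, hf, hderiv⟩ := hp.exists_hasDerivAt (b := b)
  set x := p * b * (1 - p) with hx
  have hpx : p * x = x := by
    rw [hx, ← mul_assoc, ← mul_assoc, hp.isIdempotentElem.eq]
  have hxp : x * p = 0 := by rw [hx, mul_assoc, hp.one_sub_mul_self, mul_zero]
  have hw : -(x + star x) ≠ 0 := by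
    intro h0
    refine hb ?_
    have : p * star x = 0 := by
      simpa [hp.isSelfAdjoint.star_eq] using congr(star $hxp)
    rw [neg_eq_zero] at h0
    have h1 : p * (x + star x) = x := by rw [mul_add, hpx, this, add_zero]
    rw [← h1, h0, mul_zero]
  have htend : Filter.Tendsto (fun n : ℕ => 1 / ((n : ℝ) + 1)) Filter.atTop (nhdsWithin 0 {0}ᶜ) :=
    tendsto_nhdsWithin_iff.2 ⟨tendsto_one_div_add_atTop_nhds_zero_nat,
      Filter.Eventually.of_forall fun n => (by positivity : (1 : ℝ) / ((n : ℝ) + 1) ≠ 0)⟩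
  have hne := htend.eventually (hderiv.eventually_ne (c := p) hw)
  -- The nonzero derivative keeps the curve off `p` at small nonzero times; shifting by `N` discards
  -- the other terms.
  obtain ⟨N, hN⟩ := Filter.eventually_atTop.1 hne
  replace htend := htend.comp (Filter.tendsto_add_atTop_nat N)
  set s : ℕ → ℝ := (fun n : ℕ => 1 / ((n : ℝ) + 1)) ∘ (· + N) with hs
  have hder : Filter.Tendsto (fun n => (s n)⁻¹ • (f (s n) - p)) Filter.atTop
      (nhds (-(x + star x))) := by
    have := (hasDerivAt_iff_tendsto_slope.1 hderiv).comp htend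
    refine this.congr fun n => ?_
    simp [slope_def_module, hf0]
  have hlim : Filter.Tendsto (fun n => f (s n)) Filter.atTop (nhds p) := by
    have := hderiv.continuousAt.tendsto.comp (htend.mono_right nhdsWithin_le_nhds)
    rwa [hf0] at this
  let q : ℕ → projectionSet M := fun n => ⟨⟨f (s n), (hf _).isSelfAdjoint⟩, hf _⟩
  refine ⟨q, hlim, fun n => hN _ (Nat.le_add_left N n), ?_⟩
  intro Γ _ _ _ u a hu hua
  by_contra ha
  obtain ⟨y, z, hyz, ⟨hy, hya⟩, ⟨hz, hza⟩⟩ := hua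
  have hfreq := OrderConverges.frequently_of_mem_range hyz hy hya hz hza hu ha
  have hz1 : ∀ γ, ((z γ : selfAdjoint M) : M) ≤ 1 := fun γ =>
    (mem_selfAdjointUnitBall_iff.1 (z γ).2).2
  let r : ℝ := (‖star x * x‖ + 1)⁻¹
  have hr : 0 < r := by positivity
  have hrx : r • (star x * x) ≤ 1 := by
    have h0 : 0 ≤ r • (star x * x) := smul_nonneg hr.le (star_mul_self_nonneg x)
    refine (CStarAlgebra.norm_le_one_iff_of_nonneg _).1 ?_
    rw [norm_smul, Real.norm_of_nonneg hr.le, inv_mul_le_one₀ (by positivity)]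
    linarith
  have hc0 : 0 ≤ r • (star x * x) := smul_nonneg hr.le (star_mul_self_nonneg x)
  have key := fun γ => add_smul_star_mul_self_le hp hpx hxp (fun n => hf (s n)) hlim hder (hz1 γ)
    ((hfreq γ).mono fun m hm => hm.2) hr.le hrx
  obtain ⟨γ₀⟩ := ‹Nonempty Γ›
  let d : selfAdjoint M := ⟨p + r • (star x * x), .of_nonneg (add_nonneg hp.nonneg hc0)⟩
  have hd : d ∈ selfAdjointUnitBall M := by
    refine mem_selfAdjointUnitBall_iff.2 ⟨?_, (key γ₀).2⟩
    exact (show -(1 : M) ≤ 0 from neg_nonpos.2 zero_le_one).trans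
      (show (0 : M) ≤ d from add_nonneg hp.nonneg hc0)
  let p' : selfAdjointUnitBall M := ⟨⟨p, hp.isSelfAdjoint⟩, hp.norm_le⟩
  -- The upper bounds give `p + r x⋆x ≤ a`, the lower bounds `a ≤ p`; together they force `x = 0`.
  have h1 : (⟨d, hd⟩ : selfAdjointUnitBall M) ≤ a := hza.2 (by
    rintro _ ⟨γ, rfl⟩
    exact (key γ).1)
  have h2 : a ≤ p' := hya.2 (by
    rintro _ ⟨γ, rfl⟩
    exact ge_of_tendsto_of_frequently (α := M) (a := p) hlim
      ((hfreq γ).mono fun m hm => hm.1))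
  have h3 : p + r • (star x * x) ≤ p := h1.trans h2
  have h4 : r • (star x * x) = 0 := le_antisymm (by simpa using h3) hc0
  rw [smul_eq_zero_iff_right hr.ne', CStarRing.star_mul_self_eq_zero_iff] at h4
  exact hb h4

end NotClosed

/-! ### The equivalences. -/

section Main

variable {M : Type u} [CStarAlgebra M] [PartialOrder M] [StarOrderedRing M] [WStarAlgebra M]

/-- If the trace on the projections of every order closed subset of the self-adjoint unit ball is
the trace of an order closed subset of the self-adjoint part, then the algebra is commutative. -/
theorem mul_comm_of_isClosed_preimage
    (h : ∀ X : Set (selfAdjointUnitBall M), IsOrderClosed X → ∃ Y : Set (selfAdjoint M),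
      IsOrderClosed Y ∧ (Subtype.val : projectionSet M → selfAdjoint M) ⁻¹' Y =
        inclusion (projectionSet_subset_selfAdjointUnitBall M) ⁻¹' X) (a b : M) :
    a * b = b * a := by
  refine WStarAlgebra.mul_comm_of_projections_central (fun p hp b => ?_) a b
  by_contra hb
  obtain ⟨q, hlim, hne, hclosed⟩ := exists_isOrderClosed_range_inclusion hp ⟨b, hb⟩
  obtain ⟨Y, hY, hYX⟩ := h _ hclosed
  let p' : projectionSet M := ⟨⟨p, hp.isSelfAdjoint⟩, hp⟩
  have hqY : ∀ n, (q n : selfAdjoint M) ∈ Y := by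
    intro n
    change q n ∈ Subtype.val ⁻¹' Y
    rw [hYX]
    exact ⟨n, rfl⟩
  have hpY : p' ∈ Subtype.val ⁻¹' Y := hY.mem_of_tendsto hqY hlim
  rw [hYX] at hpY
  obtain ⟨n, hn⟩ := hpY
  exact hne n congr((($hn : selfAdjointUnitBall M) : selfAdjoint M).1)

theorem proposition2p9 (M : Type u) [CStarAlgebra M] [PartialOrder M] [StarOrderedRing M]
    [WStarAlgebra M] :
    List.TFAE [
      ∀ a b : M, a * b = b * a,
      (orderConvergenceTopology (selfAdjoint M)).induced
          (Subtype.val : projectionSet M → selfAdjoint M) =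
        (orderConvergenceTopology (selfAdjointUnitBall M)).induced
          (Set.inclusion (projectionSet_subset_selfAdjointUnitBall M)),
      (orderConvergenceTopology (selfAdjoint M)).induced
          (Subtype.val : projectionSet M → selfAdjoint M) =
        orderConvergenceTopology (projectionSet M),
      (orderConvergenceTopology (selfAdjoint M)).induced
          (Subtype.val : selfAdjointUnitBall M → selfAdjoint M) =
        orderConvergenceTopology (selfAdjointUnitBall M)] := by
  tfae_have 1 → 4 := induced_val_selfAdjointUnitBall_eq M
  tfae_have 1 → 3 := induced_val_projectionSet_eq M
  tfae_have 4 → 2 := by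
    intro h
    rw [← h, induced_compose]
    rfl
  tfae_have 2 → 1 := by
    intro h
    refine mul_comm_of_isClosed_preimage fun X hX => ?_
    have : @IsClosed _ ((orderConvergenceTopology (selfAdjointUnitBall M)).induced
        (inclusion (projectionSet_subset_selfAdjointUnitBall M)))
        (inclusion (projectionSet_subset_selfAdjointUnitBall M) ⁻¹' X) :=
      (@isClosed_induced_iff _ _ (orderConvergenceTopology _) _ _).2
        ⟨X, isClosed_orderConvergenceTopology_iff.2 hX, rfl⟩
    rw [← h, @isClosed_induced_iff] at this
    simpa only [isClosed_orderConvergenceTopology_iff] using this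
  tfae_have 3 → 1 := by
    intro h
    refine mul_comm_of_isClosed_preimage fun X hX => ?_
    -- Order convergence among projections persists in the ball, so traces of order closed sets are
    -- order closed.
    have : IsOrderClosed (inclusion (projectionSet_subset_selfAdjointUnitBall M) ⁻¹' X) :=
      fun Γ _ _ _ x a hx hxa => hX Γ _ _ hx
        ((isDirectedClosed_projectionSet M).orderConverges_inclusion _ hxa)
    rw [← isClosed_orderConvergenceTopology_iff, ← h, @isClosed_induced_iff] at this
    simpa only [isClosed_orderConvergenceTopology_iff] using this
  tfae_finish

end Main
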